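/- Let $\mathbb F$ be a finite field, let $n$ be coprime to $|\mathbb F|$, and let $x^n-1=\pi_1\cdots\pi_r$ with pairwise different monic irreducible $\pi_1,\dots,\pi_r\in\mathbb F[x]$. Let $A=\mathbb F[x]/\langle x^n-1\rangle$, and let $\varepsilon_1,\dots,\varepsilon_r\in A$ be the primitive idempotents, i.e. $\varepsilon_k \bmod \pi_j=\delta_{kj}$. For $\sigma\in\mathrm{Aut}_{\mathbb F}(A)$ let $A[z;\sigma]$ be the skew polynomial ring of all $\sum_j z^ja_j$, $a_j\in A$, with multiplication determined by $az=z\sigma(a)$ for $a\in A$, and let $\mathfrak p:\mathbb F[z]^n\to A[z;\sigma]$ be the isomorphism of left $\mathbb F[z]$-modules $\sum_j z^jv_j\mapsto\sum_j z^j\mathfrak p(v_j)$, where $\mathfrak p(c_0,\dots,c_{n-1})=\sum_i c_ix^i\in A$ for $(c_0,\dots,c_{n-1})\in\mathbb F^n$. A convolutional code with parameters $(n,k,\delta)$ is a submodule $\mathcal C=\{uG\mid u\in\mathbb F[z]^k\}$ of $\mathbb F[z]^n$ with $G\in\mathbb F[z]^{k\times n}$ right invertible and $\delta$ (its complexity)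 the maximal degree of the $k$-minors of $G$. A generator matrix of $\mathcal C$ is a matrix whose rows form a basis of $\mathcal C$; it is minimal if the sum of its row degrees is $\delta$, and the row degrees of a minimal generator matrix are the Forney indices of $\mathcal C$. The code $\mathcal C$ is $\sigma$-cyclic if $\mathfrak p(\mathcal C)$ is a left ideal of $A[z;\sigma]$. For $f\in A[z;\sigma]$ put $f^{(k)}=\varepsilon_kf$ and $T_f=\{k\mid f^{(k)}\neq0\}$. Order the monomials by $z^\mu\varepsilon_k<z^\nu\varepsilon_l$ iff $\mu<\nu$, or $\mu=\nu$ and $k<l$; the leading monomial of $f=\sum_\nu\sum_j z^\nu\varepsilon_jf_\nu\ne 0$ is the largest $z^\mu\varepsilon_k$ with $\varepsilon_kf_\mu\neq0$. Call $f$ reduced if for all $k\neq l$ no nonzero term $z^\nu\varepsilon_j (f^{(k)})_\nu$ of $f^{(k)}$ is right divisible by the leading monomial of $f^{(l)}$ (there being no condition if $f^{(l)}=0$). A reduced $g$ such that $\mathfrak p(\mathcal C)=A[z;\sigma]\,g$ is called a generator polynomial of the $\sigma$-cyclic code $\mathcal C$ (it exists and is unique up to left multiplication by units of $A$); the support of $\mathcal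 C$ is $T_g$, and $\mathcal C\neq\{0\}$ is called minimal if $g=g^{(l)}$ for some $l$. **Theorem.** Let $\sigma\in\mathrm{Aut}_{\mathbb F}(A)$ and $l\in\{1,\dots,r\}$, and put $k:=\deg\pi_l$. Then the following are equivalent: (i) $\sigma(\varepsilon_l)\neq\varepsilon_l$. (ii) For every integer $d\ge0$ there exists a minimal $\sigma$-cyclic convolutional code in $\mathbb F[z]^n$ with parameters $(n,k,dk)$, with support $\{l\}$, and whose ($k$ many) Forney indices are all equal to $d$. (iii) There exists a $\sigma$-cyclic convolutional code in $\mathbb F[z]^n$ with support $\{l\}$ and nonzero complexity. -/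

import Mathlib

open Polynomial

/-! ### Convolutional codes

The codes live in `𝔽[z]^n`, modelled as `Fin n → F[X]`, where the polynomial variable plays
the role of `z`. -/

namespace ConvCode

section

variable {F : Type*} [Field F] {n k : ℕ}

/-- `G` is a generator matrix of the submodule `S` of `F[z]^n`: its rows form a basis of `S`,
that is, `G` has full row rank and `S = im G = {u G}`. -/
def IsGeneratorMatrix (G : Matrix (Fin k) (Fin n) F[X]) (S : Submodule F[X] (Fin n → F[X])) :
    Prop :=
  LinearIndependent F[X] (fun i => G i) ∧ ∀ v, v ∈ S ↔ ∃ u : Fin k → F[X], Matrix.vecMul u G = v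

/-- The complexity of `G`: the maximal degree of a `k`-minor, i.e. of a determinant formed by `k`
different columns. (The minors that vanish count as degree `0`, which does not change the maximum
if `G` has rank `k`.) -/
noncomputable def complexity (G : Matrix (Fin k) (Fin n) F[X]) : ℕ :=
  (Finset.univ : Finset (Fin k ↪ Fin n)).sup fun c => (G.submatrix id c).det.natDegree

/-- `S` is a convolutional code with parameters `(n, k, δ)`: it has a right invertible generator
matrix with `k` rows and complexity `δ`. -/
def HasParameters (S : Submodule F[X] (Fin n → F[X])) (k δ : ℕ) : Prop :=
  ∃ G : Matrix (Fin k) (Fin n) F[X], IsGeneratorMatrix G S ∧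
    (∃ G' : Matrix (Fin n) (Fin k) F[X], G * G' = 1) ∧ complexity G = δ

/-- `S` is a convolutional code (of length `n`). -/
def IsConvolutionalCode (S : Submodule F[X] (Fin n → F[X])) : Prop :=
  ∃ k δ : ℕ, HasParameters S k δ

/-- The degree in `z` of a (nonzero) vector in `F[z]^n`. -/
noncomputable def vecDegree (v : Fin n → F[X]) : ℕ :=
  Finset.univ.sup fun i => (v i).natDegree

/-- A matrix is minimal if its complexity is the sum of its row degrees. -/
def IsMinimalMatrix (G : Matrix (Fin k) (Fin n) F[X]) : Prop :=
  complexity G = ∑ i, vecDegree (G i)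

/-- `m` is the multiset of Forney indices of `S`: the row degrees of a minimal generator matrix
of `S`. -/
def HasForneyIndices (S : Submodule F[X] (Fin n → F[X])) (m : Multiset ℕ) : Prop :=
  ∃ (k : ℕ) (G : Matrix (Fin k) (Fin n) F[X]), IsGeneratorMatrix G S ∧ IsMinimalMatrix G ∧
    m = Finset.univ.val.map fun i => vecDegree (G i)

end

end ConvCode

/-! ### The skew polynomial ring `A[z;σ]` with coefficients on the right -/

/-- The Piret algebra `R[z;σ]`. Its elements are polynomials `∑ z^j a_j` over `R`, with the usual
addition, and with the multiplication determined by `a z = z σ(a)`. -/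
def PiretAlgebra {F R : Type*} [CommRing F] [CommRing R] [Algebra F R] (_σ : R ≃ₐ[F] R) : Type _ :=
  R[X]

namespace PiretAlgebra

section

variable {F R : Type*} [CommRing F] [CommRing R] [Algebra F R] (σ : R ≃ₐ[F] R)

noncomputable instance : AddCommGroup (PiretAlgebra σ) := inferInstanceAs (AddCommGroup R[X])

/-- The polynomial over `R` with right coefficients `a_j`, regarded as the element `∑ z^j a_j` of
`R[z;σ]`. -/
noncomputable def ofPoly : R[X] ≃+ PiretAlgebra σ := AddEquiv.refl R[X]

/-- The element `z^j a` of `R[z;σ]`. -/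
noncomputable def term (j : ℕ) (a : R) : PiretAlgebra σ := ofPoly σ (Polynomial.monomial j a)

variable {σ}

/-- The right coefficient `f_j` of `z^j` in `f = ∑ z^j f_j`. -/
noncomputable def coeff (f : PiretAlgebra σ) (j : ℕ) : R := ((ofPoly σ).symm f).coeff j

/-- `(∑ z^j a_j) (∑ z^l b_l) = ∑ z^(j+l) σ^l(a_j) b_l`. -/
noncomputable instance : Mul (PiretAlgebra σ) where
  mul f g := ofPoly σ (((ofPoly σ).symm f).sum fun j a => ((ofPoly σ).symm g).sum fun l b =>
    Polynomial.monomial (j + l) ((σ ^ l) a * b))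

noncomputable instance : One (PiretAlgebra σ) where
  one := term σ 0 1

theorem mul_def (f g : PiretAlgebra σ) :
    f * g = ofPoly σ (((ofPoly σ).symm f).sum fun j a => ((ofPoly σ).symm g).sum fun l b =>
      Polynomial.monomial (j + l) ((σ ^ l) a * b)) := rfl

theorem one_def : (1 : PiretAlgebra σ) = term σ 0 1 := rfl

protected theorem add_mul' (f g h : PiretAlgebra σ) : (f + g) * h = f * h + g * h := by
  rw [mul_def, mul_def, mul_def, ← map_add, map_add (ofPoly σ).symm, Polynomial.sum_add_index]
  · intro i; simp [Polynomial.sum]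
  · intro i a b
    simp [Polynomial.sum, add_mul, Finset.sum_add_distrib]

protected theorem mul_add' (f g h : PiretAlgebra σ) : f * (g + h) = f * g + f * h := by
  rw [mul_def, mul_def, mul_def, ← map_add, map_add (ofPoly σ).symm]
  congr 1
  have key : ∀ (j : ℕ) (a : R), (((ofPoly σ).symm g + (ofPoly σ).symm h).sum fun l b =>
      Polynomial.monomial (j + l) ((σ ^ l) a * b)) =
      (((ofPoly σ).symm g).sum fun l b => Polynomial.monomial (j + l) ((σ ^ l) a * b)) +
      (((ofPoly σ).symm h).sum fun l b => Polynomial.monomial (j + l) ((σ ^ l) a * b)) := by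
    intro j a
    rw [Polynomial.sum_add_index]
    · intro i; simp
    · intro i b c; simp [mul_add]
  simp only [key]
  simp [Polynomial.sum, Finset.sum_add_distrib]

theorem term_mul_term (j l : ℕ) (a b : R) :
    term σ j a * term σ l b = term σ (j + l) ((σ ^ l) a * b) := by
  rw [mul_def]
  simp only [term, AddEquiv.symm_apply_apply]
  rw [Polynomial.sum_monomial_index, Polynomial.sum_monomial_index]
  · simp
  · simp [Polynomial.sum]

theorem induction_on {P : PiretAlgebra σ → Prop} (f : PiretAlgebra σ)
    (hadd : ∀ f g, P f → P g → P (f + g)) (hterm : ∀ j a, P (term σ j a)) : P f :=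
  Polynomial.induction_on' (motive := fun p => P (ofPoly σ p)) f
    (fun p q hp hq => by rw [map_add]; exact hadd _ _ hp hq) hterm

noncomputable instance : Ring (PiretAlgebra σ) :=
  { (inferInstance : AddCommGroup (PiretAlgebra σ)),
    (inferInstance : Mul (PiretAlgebra σ)), (inferInstance : One (PiretAlgebra σ)) with
    left_distrib := PiretAlgebra.mul_add'
    right_distrib := PiretAlgebra.add_mul'
    zero_mul := fun f => by
      have h := PiretAlgebra.add_mul' 0 0 f
      rw [add_zero] at h
      exact left_eq_add.mp h
    mul_zero := fun f => by
      have h := PiretAlgebra.mul_add' f 0 0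
      rw [add_zero] at h
      exact left_eq_add.mp h
    mul_assoc := fun f g h => by
      induction f using induction_on with
      | hadd f f' hf hf' => simp only [PiretAlgebra.add_mul', hf, hf']
      | hterm j a =>
        induction g using induction_on with
        | hadd g g' hg hg' => simp only [PiretAlgebra.add_mul', PiretAlgebra.mul_add', hg, hg']
        | hterm l b =>
          induction h using induction_on with
          | hadd h h' hh hh' => simp only [PiretAlgebra.mul_add', hh, hh']
          | hterm m c =>
            simp only [term_mul_term, add_assoc, map_mul, add_comm l m, pow_add,
              AlgEquiv.mul_apply, mul_assoc]
    one_mul := fun f => by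
      induction f using induction_on with
      | hadd f f' hf hf' => simp only [PiretAlgebra.mul_add', hf, hf']
      | hterm j a => simp [one_def, term_mul_term]
    mul_one := fun f => by
      induction f using induction_on with
      | hadd f f' hf hf' => simp only [PiretAlgebra.add_mul', hf, hf']
      | hterm j a => simp [one_def, term_mul_term] }

end

end PiretAlgebra

/-! ### Cyclic convolutional codes -/

namespace CyclicConvCode

/-- The ring `A = F[x]/(x^n - 1)`. -/
abbrev CyclicRing (F : Type*) [Field F] (n : ℕ) : Type _ := AdjoinRoot (X ^ n - 1 : F[X])

/-- A prime factorization `x^n - 1 = π_1 ⋯ π_r` with pairwise different monic irreducible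
factors. -/
structure PrimeFactorization (F : Type*) [Field F] (n r : ℕ) where
  π : Fin r → F[X]
  monic : ∀ k, (π k).Monic
  irreducible : ∀ k, Irreducible (π k)
  injective : Function.Injective π
  prod_eq : ∏ k, π k = X ^ n - 1

namespace PrimeFactorization

section

variable {F : Type*} [Field F] {n r : ℕ} (P : PrimeFactorization F n r)

theorem dvd (k : Fin r) : P.π k ∣ X ^ n - 1 :=
  P.prod_eq ▸ Finset.dvd_prod_of_mem P.π (Finset.mem_univ k)

theorem isCoprime {j k : Fin r} (h : j ≠ k) : IsCoprime (P.π j) (P.π k) := by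
  rw [(P.irreducible j).coprime_iff_not_dvd]
  intro hd
  exact h (P.injective (eq_of_monic_of_associated (P.monic j) (P.monic k)
    ((P.irreducible j).associated_of_dvd (P.irreducible k) hd)))

/-- The canonical projection `ρ_k : A → K_k = F[x]/(π_k)`. -/
noncomputable def ρ (k : Fin r) : CyclicRing F n →ₐ[F] AdjoinRoot (P.π k) :=
  AdjoinRoot.algHomOfDvd F (X ^ n - 1) (P.π k) (P.dvd k)

theorem ρ_mk (k : Fin r) (p : F[X]) : P.ρ k (AdjoinRoot.mk _ p) = AdjoinRoot.mk _ p := by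
  rw [ρ, ← AdjoinRoot.aeval_eq, ← aeval_algHom_apply, AdjoinRoot.algHomOfDvd_root,
    AdjoinRoot.aeval_eq]

theorem bijective_pi_ρ : Function.Bijective (AlgHom.pi P.ρ) := by
  constructor
  · rw [injective_iff_map_eq_zero]
    intro a ha
    obtain ⟨p, rfl⟩ := AdjoinRoot.mk_surjective a
    rw [AdjoinRoot.mk_eq_zero, ← P.prod_eq]
    refine Finset.prod_dvd_of_coprime (fun i _ j _ hij => P.isCoprime hij) fun k _ => ?_
    rw [← AdjoinRoot.mk_eq_zero, ← P.ρ_mk]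
    exact congrFun ha k
  · intro b
    choose q hq using fun k => AdjoinRoot.mk_surjective (b k)
    obtain ⟨p, hp⟩ := Ideal.exists_forall_sub_mem_ideal
      (I := fun k => Ideal.span {P.π k})
      (fun i j hij => (Ideal.isCoprime_span_singleton_iff _ _).mpr (P.isCoprime hij)) q
    refine ⟨AdjoinRoot.mk _ p, funext fun k => ?_⟩
    rw [AlgHom.pi_apply, P.ρ_mk, ← hq k, AdjoinRoot.mk_eq_mk]
    exact Ideal.mem_span_singleton.mp (hp k)

/-- The isomorphism `ψ : A → K_1 × ⋯ × K_r` of the Chinese Remainder Theorem. -/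
noncomputable def ψ : CyclicRing F n ≃ₐ[F] ∀ k, AdjoinRoot (P.π k) :=
  AlgEquiv.ofBijective (AlgHom.pi P.ρ) P.bijective_pi_ρ

/-- The primitive idempotents `ε_k = ψ⁻¹(0, …, 0, 1, 0, …, 0)` of `A`. -/
noncomputable def ε (k : Fin r) : CyclicRing F n := P.ψ.symm (Pi.single k 1)

variable {σ : CyclicRing F n ≃ₐ[F] CyclicRing F n}

/-- The `k`-th component `f^(k) = ε_k f` of `f ∈ A[z;σ]`. -/
noncomputable def component (k : Fin r) (f : PiretAlgebra σ) : PiretAlgebra σ :=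
  PiretAlgebra.term σ 0 (P.ε k) * f

/-- The support of `f`: the set of all `k` such that `f^(k) ≠ 0`. -/
def support (f : PiretAlgebra σ) : Set (Fin r) := {k | P.component k f ≠ 0}

/-- The monomial `z^μ ε_k` is the leading monomial of `f`, where the monomials are ordered by
`z^μ ε_k < z^ν ε_l` if `μ < ν` or `μ = ν` and `k < l`. -/
def IsLeadingMonomial (f : PiretAlgebra σ) (μ : ℕ) (k : Fin r) : Prop :=
  P.ε k * f.coeff μ ≠ 0 ∧
    ∀ (ν : ℕ) (l : Fin r), P.ε l * f.coeff ν ≠ 0 → ν < μ ∨ (ν = μ ∧ l ≤ k)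

/-- `f` is (left) reduced: for `k ≠ l`, no nonzero term `z^ν ε_j a` of `f^(k)` is right divisible by
the leading monomial `z^μ ε_m` of `f^(l)`. -/
def IsReduced (f : PiretAlgebra σ) : Prop :=
  ∀ k l : Fin r, k ≠ l →
    ∀ (ν : ℕ) (j : Fin r), P.ε j * (P.component k f).coeff ν ≠ 0 →
      ∀ (μ : ℕ) (m : Fin r), P.IsLeadingMonomial (P.component l f) μ m →
        ¬ ∃ q : PiretAlgebra σ,
          PiretAlgebra.term σ ν (P.ε j * (P.component k f).coeff ν) =
            q * PiretAlgebra.term σ μ (P.ε m)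

end

end PrimeFactorization

section

variable {F : Type*} [Field F] {n r : ℕ}

/-- The map `𝔭 : F[z]^n → A[z;σ]`, which sends `∑ z^j v_j` to `∑ z^j 𝔭(v_j)`, where
`𝔭(c_0, …, c_(n-1)) = c_0 + c_1 x + ⋯ + c_(n-1) x^(n-1)` for `c ∈ F^n`. -/
noncomputable def 𝔭 (σ : CyclicRing F n ≃ₐ[F] CyclicRing F n) (v : Fin n → F[X]) :
    PiretAlgebra σ :=
  PiretAlgebra.ofPoly σ (∑ i : Fin n, (v i).map (algebraMap F (CyclicRing F n)) *
    C (AdjoinRoot.root (X ^ n - 1 : F[X]) ^ (i : ℕ)))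

/-- The submodule `S` is `σ`-cyclic: `𝔭(S)` is a left ideal of `A[z;σ]`. -/
def IsCyclicSubmodule (σ : CyclicRing F n ≃ₐ[F] CyclicRing F n)
    (S : Submodule F[X] (Fin n → F[X])) : Prop :=
  ∃ I : Ideal (PiretAlgebra σ), 𝔭 σ '' S = I

/-- `S` is a `σ`-cyclic convolutional code. -/
def IsCyclicCode (σ : CyclicRing F n ≃ₐ[F] CyclicRing F n)
    (S : Submodule F[X] (Fin n → F[X])) : Prop :=
  ConvCode.IsConvolutionalCode S ∧ IsCyclicSubmodule σ S

/-- `g` is a generator polynomial of `S`: it is reduced and `𝔭(S)` is the left ideal generated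
by `g`. -/
def IsGeneratorPolynomial (P : PrimeFactorization F n r)
    {σ : CyclicRing F n ≃ₐ[F] CyclicRing F n} (g : PiretAlgebra σ)
    (S : Submodule F[X] (Fin n → F[X])) : Prop :=
  P.IsReduced g ∧ 𝔭 σ '' S = (Ideal.span {g} : Ideal (PiretAlgebra σ))

/-- `T` is the support of `S`, i.e. the support of its generator polynomial. -/
def HasSupport (P : PrimeFactorization F n r) (σ : CyclicRing F n ≃ₐ[F] CyclicRing F n)
    (S : Submodule F[X] (Fin n → F[X])) (T : Set (Fin r)) : Prop :=
  ∃ g : PiretAlgebra σ, IsGeneratorPolynomial P g S ∧ P.support g = T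

/-- `S` is a minimal `σ`-cyclic convolutional code: it is nonzero and its generator polynomial
is a component. -/
def IsMinimalCyclicCode (P : PrimeFactorization F n r)
    (σ : CyclicRing F n ≃ₐ[F] CyclicRing F n) (S : Submodule F[X] (Fin n → F[X])) : Prop :=
  S ≠ ⊥ ∧ IsCyclicCode σ S ∧
    ∃ g : PiretAlgebra σ, IsGeneratorPolynomial P g S ∧ ∃ l, g = P.component l g

end

end CyclicConvCode

/-! Write `e` for the primitive idempotent `P.ε l`. If `σ` moves `e`, then `A[z;σ]` contains
invertible elements `u` for which `e u` has any prescribed degree `d` and leading coefficient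
`σ^d(e)` (`exists_unit_degree`). They are products of factors `1 + z^s a` with `z^s a` of square
zero, which exist because `e` is orthogonal to every image under an automorphism that differs from
it. The left ideal generated by `e u` then has as `F[z]`-basis the elements `b_i u`, with `b_i` an
`F`-basis of `e A`. Invertibility of `u` makes the generator matrix right invertible. Its
`z^d`-coefficients are the independent vectors `σ^d(b_i)`, so by `complexity_eq_mul` it is minimal
with all row degrees `d` (`exists_code`). If `σ` fixes `e`, then `e` is central in `A[z;σ]`. For a
generator polynomial `g = e g ≠ 0`, right multiplication by `g + (1 - e)` is injective, so its
matrix over `F[z]` has determinant `p ≠ 0`, and the adjugate shows that `p` maps `A[z;σ] e` into the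
ideal of the code. A code is saturated (`mem_of_smul_mem`), so it corresponds to all of `A[z;σ] e`;
this contains the coefficients of its elements, which forces complexity zero (`complexity_eq_zero`).
-/

/-- A matrix over a field with independent rows has a nonvanishing maximal minor. -/
theorem Matrix.exists_det_submatrix_ne_zero {K : Type*} [Field K] {k n : ℕ}
    (M : Matrix (Fin k) (Fin n) K) (h : ∃ B : Matrix (Fin n) (Fin k) K, M * B = 1) :
    ∃ c : Fin k ↪ Fin n, (M.submatrix id c).det ≠ 0 := by
  have hspan : Submodule.span K (Set.range M.col) = ⊤ := by
    rw [← Matrix.range_mulVecLin, LinearMap.range_eq_top]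
    exact Matrix.mulVec_surjective_iff_exists_right_inverse.mpr h
  -- The columns span `K^k`, so a basis can be chosen among them; its independence also makes the
  -- column indices distinct.
  have key := Submodule.exists_fun_fin_finrank_span_eq K (Set.range M.col)
  rw [hspan, finrank_top, Module.finrank_fin_fun] at key
  obtain ⟨f, hf, -, hli⟩ := key
  choose c hc using hf
  refine ⟨⟨c, fun i j hij => hli.injective (by rw [← hc, ← hc, hij])⟩, ?_⟩
  rw [← Matrix.det_transpose, ← isUnit_iff_ne_zero, ← Matrix.isUnit_iff_isUnit_det,
    ← Matrix.linearIndependent_rows_iff_isUnit]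
  have hrow : (M.submatrix id c).transpose.row = f := funext hc
  exact hrow ▸ hli

/-! ### Complexity and saturation of convolutional codes -/

namespace ConvCode

variable {F : Type*} [Field F] {n k : ℕ}

theorem linearIndependent_of_mul_eq_one {R : Type*} [CommRing R] {G : Matrix (Fin k) (Fin n) R}
    {H : Matrix (Fin n) (Fin k) R} (h : G * H = 1) : LinearIndependent R (fun i => G i) := by
  refine Matrix.vecMul_injective_iff.mp fun u v huv => ?_
  have := congrArg (fun w => Matrix.vecMul w H) huv
  simpa [Matrix.vecMul_vecMul, h] using this

/-- If all rows of `G` have degree at most `d`, and the matrix of the coefficients of `z^d` has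
full row rank, then the complexity is `k d`. -/
theorem complexity_eq_mul {G : Matrix (Fin k) (Fin n) F[X]} {d : ℕ}
    (hdeg : ∀ i j, (G i j).natDegree ≤ d)
    (hrank : ∃ B : Matrix (Fin n) (Fin k) F, (G.map fun p => p.coeff d) * B = 1) :
    complexity G = k * d := by
  apply le_antisymm
  · refine Finset.sup_le fun c _ => ?_
    rw [Matrix.det_apply]
    refine natDegree_sum_le_of_forall_le _ _ fun τ _ => ?_
    refine (natDegree_smul_le _ _).trans ((natDegree_prod_le _ _).trans ?_)
    refine (Finset.sum_le_card_nsmul _ _ d fun i _ => hdeg _ _).trans ?_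
    simp
  · obtain ⟨c, hc⟩ := Matrix.exists_det_submatrix_ne_zero _ hrank
    refine le_trans ?_ (Finset.le_sup (f := fun c : Fin k ↪ Fin n =>
      (G.submatrix id c).det.natDegree) (Finset.mem_univ c))
    -- Since all entries have degree at most `d`, the coefficient of `z^(k d)` in a minor is the
    -- same minor of the matrix of `z^d`-coefficients.
    apply le_natDegree_of_ne_zero
    convert hc using 1
    rw [Matrix.det_apply, Matrix.det_apply, finsetSum_coeff]
    refine Finset.sum_congr rfl fun τ _ => ?_
    have h := coeff_prod_of_natDegree_le (s := Finset.univ)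
      (fun i => (G.submatrix id c) (τ i) i) d fun i _ => hdeg _ _
    rw [Finset.card_univ, Fintype.card_fin] at h
    rw [Units.smul_def, Units.smul_def, coeff_smul, h]
    rfl

theorem vecDegree_eq {v : Fin n → F[X]} {d : ℕ} (hdeg : ∀ j, (v j).natDegree ≤ d)
    (hne : ∃ j, (v j).coeff d ≠ 0) : vecDegree v = d := by
  obtain ⟨j, hj⟩ := hne
  exact le_antisymm (Finset.sup_le fun i _ => hdeg i)
    ((le_natDegree_of_ne_zero hj).trans
      (Finset.le_sup (f := fun i => (v i).natDegree) (Finset.mem_univ j)))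

/-- A right invertible generator matrix of a submodule that contains all coefficient vectors of its
elements has complexity zero. -/
theorem complexity_eq_zero {S : Submodule F[X] (Fin n → F[X])}
    (hS : ∀ v ∈ S, ∀ j, (fun i => C ((v i).coeff j)) ∈ S)
    {G : Matrix (Fin k) (Fin n) F[X]} (hG : IsGeneratorMatrix G S)
    {G' : Matrix (Fin n) (Fin k) F[X]} (hG' : G * G' = 1) : complexity G = 0 := by
  obtain ⟨-, hmem⟩ := hG
  -- Evaluation at `z = 0`, with the value read as a constant polynomial. The plan is to show `G = U
  -- G(0)` with `U` unimodular.
  set ev : F[X] →+* F[X] := C.comp (evalRingHom 0) with hev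
  have hev_C : ∀ a, ev (C a) = C a := by simp [hev]
  have hev_coeff : ∀ p, ev p = C (p.coeff 0) := by simp [hev, coeff_zero_eq_eval_zero]
  have hrow : ∀ i, G i ∈ S := fun i => (hmem _).mpr ⟨Pi.single i 1, by simp [Matrix.row]⟩
  set G₀ := G.map ev with hG₀
  have hG₀' : G₀ * G'.map ev = 1 := by
    rw [hG₀, ← Matrix.map_mul, hG', Matrix.map_one _ (map_zero _) (map_one _)]
  choose W hW using fun i => (hmem _).mp (hS _ (hrow i) 0)
  have hWG : Matrix.of W * G = G₀ := by
    ext1 i j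
    rw [Matrix.mul_apply_eq_vecMul]
    refine (congrFun (hW i) j).trans ?_
    simp [hG₀, hev_coeff]
  -- A constant vector of the form `u G` also equals `u(0) G(0)`.
  have hcoef : ∀ i m, ∃ u : Fin k → F[X],
      Matrix.vecMul u G₀ = fun j => C ((G i j).coeff m) := by
    intro i m
    obtain ⟨u, hu⟩ := (hmem _).mp (hS _ (hrow i) m)
    refine ⟨fun a => ev (u a), funext fun j => ?_⟩
    rw [← hev_C, ← congrFun hu j]
    simp [hG₀, Matrix.vecMul, dotProduct, map_sum]
  choose u hu using hcoef
  set N := Finset.univ.sup fun i => vecDegree (G i)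
  set U : Matrix (Fin k) (Fin k) F[X] :=
    Matrix.of fun i => ∑ m ∈ Finset.range (N + 1), (X ^ m : F[X]) • u i m with hU
  have hUG : U * G₀ = G := by
    ext1 i j
    rw [Matrix.mul_apply_eq_vecMul]
    have hlt : (G i j).natDegree < N + 1 := Nat.lt_succ_of_le <|
      (Finset.le_sup (f := fun j => (G i j).natDegree) (Finset.mem_univ j)).trans
        (Finset.le_sup (f := fun i => vecDegree (G i)) (Finset.mem_univ i))
    have hUi : U i = ∑ m ∈ Finset.range (N + 1), (X ^ m : F[X]) • u i m := rfl
    simp only [hUi, Matrix.sum_vecMul, Matrix.smul_vecMul, hu, Finset.sum_apply, Pi.smul_apply,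
      smul_eq_mul]
    conv_rhs => rw [as_sum_range' _ _ hlt]
    refine Finset.sum_congr rfl fun m _ => ?_
    rw [mul_comm, C_mul_X_pow_eq_monomial]
  have hWU : Matrix.of W * U = 1 := by
    rw [← Matrix.mul_one (Matrix.of W * U), ← hG₀', ← Matrix.mul_assoc, Matrix.mul_assoc _ U, hUG,
      hWG]
  have hdet : IsUnit U.det := by
    refine IsUnit.of_mul_eq_one_right (Matrix.of W).det ?_
    rw [← Matrix.det_mul, hWU, Matrix.det_one]
  -- Each minor of `G` is the unit `det U` times a minor of the constant matrix `G₀`.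
  refine Nat.le_zero.mp (Finset.sup_le fun c _ => ?_)
  have hc : G.submatrix id c = U * ((G₀.submatrix id c)) := by
    conv_lhs => rw [← hUG]
    rfl
  have hc' : (G₀.submatrix id c).det = ev (G.submatrix id c).det := by
    rw [RingHom.map_det]; rfl
  rw [hc, Matrix.det_mul, hc', hev_coeff]
  refine natDegree_mul_le.trans ?_
  rw [natDegree_eq_zero_of_isUnit hdet, natDegree_C]

/-- The right inverse recovers coordinates: `p v = u G` gives `u = p (v G')`, and `p` cancels. Thus
`F[z]^n / S` is torsion-free. -/
theorem mem_of_smul_mem {S : Submodule F[X] (Fin n → F[X])}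
    {G : Matrix (Fin k) (Fin n) F[X]} (hG : IsGeneratorMatrix G S)
    {G' : Matrix (Fin n) (Fin k) F[X]} (hG' : G * G' = 1) {p : F[X]} (hp : p ≠ 0)
    {v : Fin n → F[X]} (hv : p • v ∈ S) : v ∈ S := by
  obtain ⟨u, hu⟩ := (hG.2 _).mp hv
  refine (hG.2 _).mpr ⟨Matrix.vecMul v G', ?_⟩
  have : u = p • Matrix.vecMul v G' := by
    rw [← Matrix.smul_vecMul, ← hu, Matrix.vecMul_vecMul, hG', Matrix.vecMul_one]
  rw [this, Matrix.smul_vecMul] at hu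
  exact smul_right_injective _ hp hu

end ConvCode

/-! ### Coefficients of products in the skew polynomial ring -/

namespace PiretAlgebra

variable {F R : Type*} [CommRing F] [CommRing R] [Algebra F R] {σ : R ≃ₐ[F] R}

theorem ext_coeff {f g : PiretAlgebra σ} (h : ∀ j, f.coeff j = g.coeff j) : f = g :=
  (ofPoly σ).symm.injective (Polynomial.ext h)

@[simp] theorem coeff_zero (j : ℕ) : (0 : PiretAlgebra σ).coeff j = 0 := by
  simp [coeff]

@[simp] theorem coeff_add (f g : PiretAlgebra σ) (j : ℕ) :
    (f + g).coeff j = f.coeff j + g.coeff j := by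
  simp [coeff]

/-- The coefficient of `z^j`, as an additive map. -/
noncomputable def coeffHom (j : ℕ) : PiretAlgebra σ →+ R where
  toFun f := f.coeff j
  map_zero' := coeff_zero j
  map_add' f g := coeff_add f g j

@[simp] theorem coeff_sum {ι : Type*} (s : Finset ι) (f : ι → PiretAlgebra σ) (j : ℕ) :
    (∑ i ∈ s, f i).coeff j = ∑ i ∈ s, (f i).coeff j :=
  map_sum (coeffHom j) f s

theorem coeff_term (j : ℕ) (a : R) (m : ℕ) : (term σ j a).coeff m = if j = m then a else 0 := by
  simp [coeff, term, coeff_monomial]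

theorem coeff_mul (f g : PiretAlgebra σ) (m : ℕ) :
    (f * g).coeff m = ∑ x ∈ Finset.HasAntidiagonal.antidiagonal m, (σ ^ x.2) (f.coeff x.1) * g.coeff x.2 := by
  induction f using induction_on with
  | hadd f f' hf hf' => simp only [add_mul, coeff_add, hf, hf', map_add, Finset.sum_add_distrib]
  | hterm j a =>
    induction g using induction_on with
    | hadd g g' hg hg' => simp only [mul_add, coeff_add, hg, hg', Finset.sum_add_distrib]
    | hterm l b =>
      rw [term_mul_term, coeff_term]
      split_ifs with h
      · rw [Finset.sum_eq_single (j, l)]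
        · simp [coeff_term]
        · rintro ⟨x, y⟩ - hxy
          simp only [coeff_term]
          by_cases hx : j = x
          · have hy : l ≠ y := fun hy => hxy (by rw [hx, hy])
            simp [hy]
          · simp [hx]
        · exact fun hx => absurd (Finset.HasAntidiagonal.mem_antidiagonal.mpr h) hx
      · refine (Finset.sum_eq_zero ?_).symm
        rintro ⟨x, y⟩ hxy
        simp only [coeff_term]
        by_cases hx : j = x
        · have hy : l ≠ y := fun hy => h (by rw [hx, hy]; exact Finset.HasAntidiagonal.mem_antidiagonal.mp hxy)
          simp [hy]
        · simp [hx]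

theorem coeff_term_zero_mul (a : R) (f : PiretAlgebra σ) (m : ℕ) :
    (term σ 0 a * f).coeff m = (σ ^ m) a * f.coeff m := by
  rw [coeff_mul, Finset.sum_eq_single (0, m)]
  · simp [coeff_term]
  · rintro ⟨x, y⟩ hx hxy
    have : x ≠ 0 := by
      rintro rfl
      exact hxy (by rw [← Finset.HasAntidiagonal.mem_antidiagonal.mp hx, zero_add])
    simp [coeff_term, this.symm]
  · simp

theorem coeff_mul_term_zero (f : PiretAlgebra σ) (a : R) (m : ℕ) :
    (f * term σ 0 a).coeff m = f.coeff m * a := by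
  rw [coeff_mul, Finset.sum_eq_single (m, 0)]
  · simp [coeff_term]
  · rintro ⟨x, y⟩ hx hxy
    have : y ≠ 0 := by
      rintro rfl
      exact hxy (by rw [← Finset.HasAntidiagonal.mem_antidiagonal.mp hx, add_zero])
    simp [coeff_term, this.symm]
  · simp

/-- Only the pair `(J, D)` contributes. The value may vanish, because `R` may have zero divisors. -/
theorem coeff_mul_top {f g : PiretAlgebra σ} {J D : ℕ} (hf : ∀ j, J < j → f.coeff j = 0)
    (hg : ∀ j, D < j → g.coeff j = 0) :
    (f * g).coeff (J + D) = (σ ^ D) (f.coeff J) * g.coeff D := by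
  rw [coeff_mul, Finset.sum_eq_single (J, D)]
  · rintro ⟨x, y⟩ hx hxy
    have hsum := Finset.HasAntidiagonal.mem_antidiagonal.mp hx
    dsimp only at hsum ⊢
    rcases lt_trichotomy x J with h | h | h
    · rw [hg y (by omega), mul_zero]
    · exact absurd (by rw [h, show y = D by omega]) hxy
    · rw [hf x h, map_zero, zero_mul]
  · simp

theorem exists_top_coeff {f : PiretAlgebra σ} (hf : f ≠ 0) :
    ∃ D, f.coeff D ≠ 0 ∧ ∀ j, D < j → f.coeff j = 0 := by
  refine ⟨((ofPoly σ).symm f).natDegree, ?_, fun j hj => coeff_eq_zero_of_natDegree_lt hj⟩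
  rw [coeff, coeff_natDegree, Ne, leadingCoeff_eq_zero]
  exact fun h => hf ((map_eq_zero_iff _ (ofPoly σ).symm.injective).mp h)

theorem term_zero_right (j : ℕ) : term σ j 0 = 0 := by
  simp [term]

variable (σ) in
/-- The embedding `F[z] → R[z;σ]`. -/
noncomputable def ofBase (p : F[X]) : PiretAlgebra σ := ofPoly σ (p.map (algebraMap F R))

/-- As `σ` is `F`-linear, left multiplication by elements of `F[z]` sees no twist. -/
theorem ofBase_mul (p : F[X]) (f : PiretAlgebra σ) :
    ofBase σ p * f = ofPoly σ (p.map (algebraMap F R) * (ofPoly σ).symm f) := by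
  refine ext_coeff fun m => ?_
  rw [PiretAlgebra.coeff_mul, coeff, AddEquiv.symm_apply_apply, Polynomial.coeff_mul]
  refine Finset.sum_congr rfl fun x _ => ?_
  simp [ofBase, coeff]

end PiretAlgebra

/-! ### The isomorphism `𝔭` and matrices of right multiplications -/

namespace CyclicConvCode

open PiretAlgebra

variable {F : Type*} [Field F] {n : ℕ} [NeZero n]

theorem exists_basis_root_pow (F : Type*) [Field F] (n : ℕ) [NeZero n] :
    ∃ b : Module.Basis (Fin n) F (CyclicRing F n),
      ∀ i, b i = AdjoinRoot.root (X ^ n - 1 : F[X]) ^ (i : ℕ) := by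
  have hm : (X ^ n - 1 : F[X]).Monic := by
    simpa using monic_X_pow_sub_C (1 : F) (NeZero.ne n)
  have hd : (X ^ n - 1 : F[X]).natDegree = n := by
    simpa using natDegree_X_pow_sub_C (n := n) (r := (1 : F))
  refine ⟨(AdjoinRoot.powerBasis' hm).basis.reindex (finCongr hd), fun i => ?_⟩
  rw [Module.Basis.reindex_apply, PowerBasis.basis_eq_pow]
  rfl

/-- The basis `1, x, …, x^(n-1)` of `A`. -/
noncomputable def rootBasis (F : Type*) [Field F] (n : ℕ) [NeZero n] :
    Module.Basis (Fin n) F (CyclicRing F n) :=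
  (exists_basis_root_pow F n).choose

variable {σ : CyclicRing F n ≃ₐ[F] CyclicRing F n}

theorem coeff_𝔭 (v : Fin n → F[X]) (j : ℕ) :
    (𝔭 σ v).coeff j = (rootBasis F n).equivFun.symm fun i => (v i).coeff j := by
  rw [𝔭, PiretAlgebra.coeff, AddEquiv.symm_apply_apply, finsetSum_coeff, Module.Basis.equivFun_symm_apply]
  refine Finset.sum_congr rfl fun i _ => ?_
  rw [coeff_mul_C, coeff_map, rootBasis, (exists_basis_root_pow F n).choose_spec,
    Algebra.smul_def]

theorem equivFun_coeff_𝔭 (v : Fin n → F[X]) (j : ℕ) (i : Fin n) :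
    (rootBasis F n).equivFun ((𝔭 σ v).coeff j) i = (v i).coeff j := by
  rw [coeff_𝔭, LinearEquiv.apply_symm_apply]

theorem 𝔭_injective : Function.Injective (𝔭 σ) := by
  intro v w h
  ext i j
  rw [← equivFun_coeff_𝔭 (σ := σ), h, equivFun_coeff_𝔭]

theorem 𝔭_surjective : Function.Surjective (𝔭 σ) := by
  intro f
  set N := ((ofPoly σ).symm f).natDegree
  refine ⟨fun i => ∑ j ∈ Finset.range (N + 1),
    monomial j ((rootBasis F n).equivFun (f.coeff j) i), ext_coeff fun j => ?_⟩
  rw [coeff_𝔭, LinearEquiv.symm_apply_eq]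
  funext i
  simp only [finsetSum_coeff, coeff_monomial, Finset.sum_ite_eq', Finset.mem_range]
  split_ifs with h
  · rfl
  · have : f.coeff j = 0 := coeff_eq_zero_of_natDegree_lt (by omega)
    simp [this]

theorem 𝔭_add (v w : Fin n → F[X]) : 𝔭 σ (v + w) = 𝔭 σ v + 𝔭 σ w := by
  refine ext_coeff fun j => ?_
  rw [PiretAlgebra.coeff_add, coeff_𝔭, coeff_𝔭, coeff_𝔭, ← map_add]
  congr 1

variable (σ) in
/-- `𝔭` as an isomorphism of additive groups. -/
noncomputable def 𝔭Equiv : (Fin n → F[X]) ≃+ PiretAlgebra σ :=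
  AddEquiv.ofBijective (AddMonoidHom.mk' (𝔭 σ) 𝔭_add) ⟨𝔭_injective, 𝔭_surjective⟩

theorem 𝔭Equiv_apply (v : Fin n → F[X]) : 𝔭Equiv σ v = 𝔭 σ v := rfl

theorem 𝔭Equiv_smul (p : F[X]) (v : Fin n → F[X]) :
    𝔭Equiv σ (p • v) = ofBase σ p * 𝔭Equiv σ v := by
  rw [ofBase_mul, 𝔭Equiv_apply, 𝔭Equiv_apply, 𝔭, 𝔭, AddEquiv.symm_apply_apply, Finset.mul_sum]
  simp [mul_assoc]

theorem 𝔭Equiv_sum_smul {k : ℕ} (u : Fin k → F[X]) (G : Fin k → Fin n → F[X]) :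
    𝔭Equiv σ (∑ i, u i • G i) = ∑ i, ofBase σ (u i) * 𝔭Equiv σ (G i) := by
  rw [map_sum]
  exact Finset.sum_congr rfl fun i _ => 𝔭Equiv_smul _ _

/-- The matrix over `F[z]` that describes the right multiplication by `u`. -/
noncomputable def rightMulMatrix (u : PiretAlgebra σ) : Matrix (Fin n) (Fin n) F[X] :=
  Matrix.of fun c => (𝔭Equiv σ).symm (𝔭Equiv σ (Pi.single c 1) * u)

theorem 𝔭Equiv_row_rightMulMatrix (u : PiretAlgebra σ) (c : Fin n) :
    𝔭Equiv σ ((rightMulMatrix u).row c) = 𝔭Equiv σ (Pi.single c 1) * u :=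
  AddEquiv.apply_symm_apply _ _

theorem 𝔭Equiv_vecMul_rightMulMatrix (v : Fin n → F[X]) (u : PiretAlgebra σ) :
    𝔭Equiv σ (Matrix.vecMul v (rightMulMatrix u)) = 𝔭Equiv σ v * u := by
  have hv : v = ∑ c, v c • Pi.single c (1 : F[X]) := (pi_eq_sum_univ' v).trans (by
    refine Finset.sum_congr rfl fun c _ => congrArg _ (funext fun j => ?_)
    simp [Pi.single_apply])
  rw [Matrix.vecMul_eq_sum]
  refine (𝔭Equiv_sum_smul _ (rightMulMatrix u).row).trans ?_
  conv_rhs => rw [hv, 𝔭Equiv_sum_smul, Finset.sum_mul]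
  refine Finset.sum_congr rfl fun c _ => ?_
  rw [𝔭Equiv_row_rightMulMatrix, mul_assoc]

/-- Right multiplications act on row vectors, so the order of factors is preserved, and a right
inverse of `u` yields a right inverse of its matrix. -/
theorem rightMulMatrix_mul (u w : PiretAlgebra σ) :
    rightMulMatrix u * rightMulMatrix w = rightMulMatrix (u * w) := by
  ext1 c j
  rw [Matrix.mul_apply_eq_vecMul]
  refine congrFun ((𝔭Equiv σ).injective ?_) j
  refine (𝔭Equiv_vecMul_rightMulMatrix ((rightMulMatrix u).row c) w).trans ?_
  rw [𝔭Equiv_row_rightMulMatrix, mul_assoc]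
  exact (𝔭Equiv_row_rightMulMatrix (u * w) c).symm

theorem rightMulMatrix_one : rightMulMatrix (1 : PiretAlgebra σ) = 1 := by
  ext1 c j
  simp [rightMulMatrix, Matrix.one_apply, Pi.single_apply, eq_comm]

end CyclicConvCode

theorem Matrix.exists_mul_eq_one_of_linearIndependent_row {K : Type*} [Field K] {k n : ℕ}
    (M : Matrix (Fin k) (Fin n) K) (h : LinearIndependent K M.row) :
    ∃ B : Matrix (Fin n) (Fin k) K, M * B = 1 := by
  rw [← Matrix.mulVec_surjective_iff_exists_right_inverse]
  rw [← Matrix.coe_mulVecLin, ← LinearMap.range_eq_top]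
  refine Submodule.eq_top_of_finrank_eq ?_
  have := h.rank_matrix
  rw [Matrix.rank] at this
  rw [this, Module.finrank_fin_fun, Fintype.card_fin]

/-! ### Primitive idempotents of `A` -/

namespace CyclicConvCode.PrimeFactorization

variable {F : Type*} [Field F] {n r : ℕ} (P : PrimeFactorization F n r)

theorem ne_zero_length (P : PrimeFactorization F n r) : n ≠ 0 := by
  rintro rfl
  have h := P.prod_eq
  rw [pow_zero, sub_self, Finset.prod_eq_zero_iff] at h
  obtain ⟨k, -, hk⟩ := h
  exact (P.irreducible k).ne_zero hk

theorem ψ_ε (k : Fin r) : P.ψ (P.ε k) = Pi.single k 1 := P.ψ.apply_symm_apply _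

theorem ψ_apply (a : CyclicRing F n) (k : Fin r) : P.ψ a k = P.ρ k a := rfl

theorem ε_mul_self (k : Fin r) : P.ε k * P.ε k = P.ε k := by
  apply P.ψ.injective
  rw [map_mul, ψ_ε, ← Pi.single_mul, one_mul]

theorem ε_mul_ε_of_ne {j k : Fin r} (h : j ≠ k) : P.ε j * P.ε k = 0 := by
  apply P.ψ.injective
  rw [map_mul, ψ_ε, ψ_ε, map_zero]
  funext i
  rcases eq_or_ne i j with rfl | hi
  · simp [h]
  · simp [hi]

theorem sum_ε : ∑ k, P.ε k = 1 := by
  apply P.ψ.injective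
  rw [map_sum, map_one]
  simp only [ψ_ε]
  exact Finset.univ_sum_single 1

theorem ε_mul_eq_iff {k : Fin r} {a b : CyclicRing F n} :
    P.ε k * a = P.ε k * b ↔ P.ρ k a = P.ρ k b := by
  rw [← P.ψ.injective.eq_iff, map_mul, map_mul, ψ_ε]
  constructor
  · intro h
    simpa [ψ_apply] using congrFun h k
  · intro h
    funext i
    rcases eq_or_ne i k with rfl | hi
    · simpa [ψ_apply] using h
    · simp [hi]

/-- The ideal `ε_k A` is a copy of the field `F[x]/(π_k)`. -/
theorem ε_mul_mul_ne_zero {k : Fin r} {a b : CyclicRing F n} (ha : P.ε k * a ≠ 0)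
    (hb : P.ε k * b ≠ 0) : P.ε k * (a * b) ≠ 0 := by
  have := Fact.mk (P.irreducible k)
  rw [← mul_zero (P.ε k), Ne, ε_mul_eq_iff, map_zero] at ha hb ⊢
  rw [map_mul]
  exact mul_ne_zero ha hb

theorem ε_mul_idempotent (k : Fin r) {a : CyclicRing F n} (ha : a * a = a) :
    P.ε k * a = 0 ∨ P.ε k * a = P.ε k := by
  have := Fact.mk (P.irreducible k)
  have h : P.ρ k a * P.ρ k a = P.ρ k a := by rw [← map_mul, ha]
  rcases IsIdempotentElem.iff_eq_zero_or_one.mp h with h | h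
  · left
    rw [← mul_zero (P.ε k), ε_mul_eq_iff, h, map_zero]
  · right
    conv_rhs => rw [← mul_one (P.ε k)]
    rw [ε_mul_eq_iff, h, map_one]

theorem ε_ne_zero (k : Fin r) : P.ε k ≠ 0 := by
  have := Fact.mk (P.irreducible k)
  intro h
  have := congrFun (P.ψ_ε k) k
  rw [h, map_zero] at this
  simp at this

/-- An automorphism either fixes a primitive idempotent or sends it to an orthogonal one. -/
theorem map_ε_mul_ε (k : Fin r) (τ : CyclicRing F n ≃ₐ[F] CyclicRing F n)
    (h : τ (P.ε k) ≠ P.ε k) : τ (P.ε k) * P.ε k = 0 := by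
  rcases P.ε_mul_idempotent k (a := τ (P.ε k)) (by rw [← map_mul, ε_mul_self]) with h1 | h1
  · rw [mul_comm, h1]
  -- So far `ε_k` is only a multiple of `τ(ε_k)`. The same dichotomy for the preimage gives
  -- orthogonality or the reverse divisibility, and the latter forces equality.
  rcases P.ε_mul_idempotent k (a := τ.symm (P.ε k)) (by rw [← map_mul, ε_mul_self]) with h2 | h2
  · have := congrArg τ h2
    rwa [map_mul, AlgEquiv.apply_symm_apply, map_zero] at this
  · have := congrArg τ h2
    rw [map_mul, AlgEquiv.apply_symm_apply, mul_comm, h1] at this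
    exact absurd this.symm h

/-- The ideal `ε_k A` has an `F`-basis of length `deg π_k`. -/
theorem exists_basis_ε (k : Fin r) : ∃ b : Fin (P.π k).natDegree → CyclicRing F n,
    LinearIndependent F b ∧ (∀ i, P.ε k * b i = b i) ∧
      ∀ a, ∃ c : Fin (P.π k).natDegree → F, P.ε k * a = ∑ i, c i • b i := by
  classical
  let β := AdjoinRoot.powerBasisAux (P.irreducible k).ne_zero
  let f : AdjoinRoot (P.π k) →ₗ[F] CyclicRing F n :=
    P.ψ.symm.toLinearMap ∘ₗ LinearMap.single F (fun k => AdjoinRoot (P.π k)) k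
  have hf : ∀ x, f x = P.ψ.symm (Pi.single k x) := fun x => rfl
  refine ⟨fun i => f (β i), β.linearIndependent.map' f ?_, fun i => ?_, fun a => ?_⟩
  · rw [LinearMap.ker_eq_bot]
    exact P.ψ.symm.injective.comp
      (Pi.single_injective (M := fun k => AdjoinRoot (P.π k)) k)
  · dsimp only
    rw [hf, ε, ← map_mul, ← Pi.single_mul, one_mul]
  · refine ⟨fun i => β.repr (P.ρ k a) i, ?_⟩
    simp only [← map_smul]
    rw [← map_sum, β.sum_repr, hf, P.ψ.eq_symm_apply, map_mul, ψ_ε]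
    funext i
    rcases eq_or_ne i k with rfl | hi
    · simp [ψ_apply]
    · simp [hi]

end CyclicConvCode.PrimeFactorization

/-! ### Units of the skew polynomial ring and components -/

namespace PiretAlgebra

variable {F R : Type*} [CommRing F] [CommRing R] [Algebra F R] {σ : R ≃ₐ[F] R}

/-- The hypothesis says that `z^d a` has square `z^(2d) σ^d(a) a = 0`. -/
theorem one_add_mul_one_sub_term {d : ℕ} {a : R} (h : (σ ^ d) a * a = 0) :
    (1 + term σ d a) * (1 - term σ d a) = 1 := by
  have h0 : term σ d a * term σ d a = 0 := by rw [term_mul_term, h, term_zero_right]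
  have : (1 + term σ d a) * (1 - term σ d a) = 1 - term σ d a * term σ d a := by noncomm_ring
  rw [this, h0, sub_zero]

end PiretAlgebra

namespace CyclicConvCode

open PiretAlgebra

variable {F : Type*} [Field F] {n r : ℕ}

namespace PrimeFactorization

variable (P : PrimeFactorization F n r) {σ : CyclicRing F n ≃ₐ[F] CyclicRing F n}

/-- If `ε_l` is not fixed by `σ`, then `ε_l u` has degree `d` and leading coefficient `σ^d(ε_l)`
for some invertible `u`. -/
theorem exists_unit_degree {l : Fin r} (hσ : σ (P.ε l) ≠ P.ε l) (d : ℕ) :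
    ∃ u w : PiretAlgebra σ, u * w = 1 ∧
      (term σ 0 (P.ε l) * u).coeff d = (σ ^ d) (P.ε l) ∧
      ∀ j, d < j → (term σ 0 (P.ε l) * u).coeff j = 0 := by
  have hee := P.ε_mul_self l
  by_cases hd : (σ ^ d) (P.ε l) = P.ε l
  · rcases Nat.eq_zero_or_pos d with rfl | hpos
    · refine ⟨1, 1, one_mul 1, ?_, fun j hj => ?_⟩
      · rw [mul_one, coeff_term, if_pos rfl, pow_zero, AlgEquiv.one_apply]
      · rw [mul_one, coeff_term, if_neg hj.ne]
    -- Now `σ^d` fixes `ε_l`, so `z^d ε_l` is not of square zero and one factor does not suffice.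
    -- The degree is split as `1 + t`; neither `σ` nor `σ^t` fixes `ε_l`, so both factors below are
    -- invertible.
    obtain ⟨t, rfl⟩ := Nat.exists_eq_add_of_le' hpos
    have hsucc : (σ ^ t) (σ (P.ε l)) = P.ε l := by
      rw [← AlgEquiv.mul_apply, ← pow_succ, hd]
    have ht : (σ ^ t) (P.ε l) * P.ε l = 0 := by
      refine P.map_ε_mul_ε l _ fun h => hσ ?_
      have h2 : σ ((σ ^ t) (P.ε l)) = P.ε l := by
        rw [← AlgEquiv.mul_apply, ← pow_succ', hd]
      rwa [h] at h2
    have ht0 : t ≠ 0 := by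
      rintro rfl
      rw [pow_zero, AlgEquiv.one_apply] at hsucc
      exact hσ hsucc
    have h1 : (σ ^ 1) (σ (P.ε l)) * σ (P.ε l) = 0 := by
      rw [pow_one, ← map_mul, P.map_ε_mul_ε l σ hσ, map_zero]
    -- The `z^t` term drops out because `σ^t(ε_l) ε_l = 0`; the top term survives because
    -- `σ^t(σ(ε_l)) = ε_l`.
    have hmul : term σ 0 (P.ε l) * ((1 + term σ 1 (σ (P.ε l))) * (1 + term σ t (P.ε l))) =
        term σ 0 (P.ε l) + term σ 1 (σ (P.ε l)) + term σ (t + 1) (P.ε l) := by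
      simp only [mul_add, add_mul, mul_one, one_mul, term_mul_term, zero_add, pow_one,
        ← map_mul, hee, ht, term_zero_right, add_zero, ← add_assoc, hsucc]
      rw [add_comm 1 t, hd, hee]
    refine ⟨(1 + term σ 1 (σ (P.ε l))) * (1 + term σ t (P.ε l)),
      (1 - term σ t (P.ε l)) * (1 - term σ 1 (σ (P.ε l))), ?_, ?_, fun j hj => ?_⟩
    · rw [mul_assoc, ← mul_assoc (1 + term σ t (P.ε l)), one_add_mul_one_sub_term ht, one_mul,
        one_add_mul_one_sub_term h1]
    · rw [hmul, PiretAlgebra.coeff_add, PiretAlgebra.coeff_add, coeff_term, coeff_term, coeff_term, if_neg (by omega),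
        if_neg (by omega), if_pos rfl, zero_add, zero_add, hd]
    · rw [hmul, PiretAlgebra.coeff_add, PiretAlgebra.coeff_add, coeff_term, coeff_term, coeff_term, if_neg (by omega),
        if_neg (by omega), if_neg (by omega), zero_add, zero_add]
  · have hd0 : d ≠ 0 := by
      rintro rfl
      exact hd rfl
    have h1 : (σ ^ d) ((σ ^ d) (P.ε l)) * (σ ^ d) (P.ε l) = 0 := by
      -- The required product is the image under `σ^d` of `σ^d(ε_l) ε_l`.
      rw [← map_mul, P.map_ε_mul_ε l _ hd, map_zero]
    have hmul : term σ 0 (P.ε l) * (1 + term σ d ((σ ^ d) (P.ε l))) =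
        term σ 0 (P.ε l) + term σ d ((σ ^ d) (P.ε l)) := by
      rw [mul_add, mul_one, term_mul_term, ← map_mul, hee, zero_add]
    refine ⟨1 + term σ d ((σ ^ d) (P.ε l)), 1 - term σ d ((σ ^ d) (P.ε l)),
      one_add_mul_one_sub_term h1, ?_, fun j hj => ?_⟩
    · rw [hmul, PiretAlgebra.coeff_add, coeff_term, coeff_term, if_neg hd0.symm, if_pos rfl, zero_add]
    · rw [hmul, PiretAlgebra.coeff_add, coeff_term, coeff_term, if_neg (by omega), if_neg hj.ne, zero_add]

theorem component_component_of_ne {j k : Fin r} (h : j ≠ k) (f : PiretAlgebra σ) :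
    P.component j (P.component k f) = 0 := by
  rw [component, component, ← mul_assoc, term_mul_term, pow_zero, AlgEquiv.one_apply,
    P.ε_mul_ε_of_ne h, term_zero_right, zero_mul]

theorem component_component_self (k : Fin r) (f : PiretAlgebra σ) :
    P.component k (P.component k f) = P.component k f := by
  rw [component, component, ← mul_assoc, term_mul_term, pow_zero, AlgEquiv.one_apply,
    P.ε_mul_self, zero_add]

theorem support_component (k : Fin r) {f : PiretAlgebra σ} (hf : P.component k f ≠ 0) :
    P.support (P.component k f) = {k} := by
  ext j
  rw [support, Set.mem_ofPred_eq, Set.mem_singleton_iff]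
  constructor
  · intro h
    by_contra hjk
    exact h (P.component_component_of_ne hjk f)
  · rintro rfl
    rwa [component_component_self]

/-- At most one component is nonzero, so the condition on pairs of distinct components is vacuous.
-/
theorem isReduced_component (k : Fin r) (f : PiretAlgebra σ) :
    P.IsReduced (P.component k f) := by
  intro i j hij ν a hν μ m hμ
  exfalso
  rcases eq_or_ne i k with rfl | hi
  · rw [P.component_component_of_ne hij.symm] at hμ
    exact hμ.1 (by rw [PiretAlgebra.coeff_zero, mul_zero])
  · rw [P.component_component_of_ne hi] at hν
    exact hν (by rw [PiretAlgebra.coeff_zero, mul_zero])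

theorem component_eq_self_of_support {g : PiretAlgebra σ} {l : Fin r} (h : P.support g = {l}) :
    P.component l g = g := by
  have hsum : ∑ k, P.component k g = g := by
    refine ext_coeff fun m => ?_
    simp only [component, PiretAlgebra.coeff_sum, coeff_term_zero_mul]
    rw [← Finset.sum_mul, ← map_sum, P.sum_ε, map_one, one_mul]
  conv_rhs => rw [← hsum]
  refine (Finset.sum_eq_single (f := fun k => P.component k g) l (fun k _ hk => ?_) fun h => absurd (Finset.mem_univ l) h).symm
  by_contra hne
  have : k ∈ P.support g := hne
  rw [h] at this
  exact hk this

end PrimeFactorization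

/-- The submodule of `F[z]^n` that corresponds to a left ideal of `A[z;σ]`. -/
noncomputable def codeOfIdeal [NeZero n] {σ : CyclicRing F n ≃ₐ[F] CyclicRing F n}
    (I : Ideal (PiretAlgebra σ)) : Submodule F[X] (Fin n → F[X]) where
  carrier := {v | 𝔭Equiv σ v ∈ I}
  add_mem' {v w} hv hw := by
    rw [Set.mem_ofPred_eq, map_add]
    exact I.add_mem hv hw
  zero_mem' := by
    rw [Set.mem_ofPred_eq, map_zero]
    exact I.zero_mem
  smul_mem' p v hv := by
    rw [Set.mem_ofPred_eq, 𝔭Equiv_smul]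
    exact I.mul_mem_left _ hv

variable [NeZero n] {σ : CyclicRing F n ≃ₐ[F] CyclicRing F n}

theorem mem_codeOfIdeal {I : Ideal (PiretAlgebra σ)} {v : Fin n → F[X]} :
    v ∈ codeOfIdeal I ↔ 𝔭Equiv σ v ∈ I := Iff.rfl

theorem image_codeOfIdeal (I : Ideal (PiretAlgebra σ)) : 𝔭 σ '' (codeOfIdeal I) = I :=
  Set.image_preimage_eq (I : Set (PiretAlgebra σ)) 𝔭_surjective

theorem 𝔭Equiv_const (a : CyclicRing F n) :
    𝔭Equiv σ (fun i => C ((rootBasis F n).equivFun a i)) = term σ 0 a := by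
  refine ext_coeff fun m => ?_
  rw [𝔭Equiv_apply, coeff_𝔭, LinearEquiv.symm_apply_eq, coeff_term]
  funext i
  rw [coeff_C]
  rcases eq_or_ne m 0 with rfl | hm
  · simp
  · simp [hm, hm.symm]

end CyclicConvCode

/-! ### Construction of the codes, and the case of a fixed idempotent -/

namespace CyclicConvCode.PrimeFactorization

open PiretAlgebra ConvCode

variable {F : Type*} [Field F] {n r : ℕ} (P : PrimeFactorization F n r)
  {σ : CyclicRing F n ≃ₐ[F] CyclicRing F n}

/-- Powers of `z` stand to the left of coefficients, so an `F`-spanning family of `ε_l A` spans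
`A[z;σ] ε_l` over `F[z]`. -/
theorem exists_sum_ofBase_mul_term {l : Fin r} {b : Fin (P.π l).natDegree → CyclicRing F n}
    (hb : ∀ a, ∃ c : Fin (P.π l).natDegree → F, P.ε l * a = ∑ i, c i • b i)
    (f : PiretAlgebra σ) : ∃ u : Fin (P.π l).natDegree → F[X],
      f * term σ 0 (P.ε l) = ∑ i, ofBase σ (u i) * term σ 0 (b i) := by
  induction f using PiretAlgebra.induction_on with
  | hadd f g hf hg =>
    obtain ⟨u, hu⟩ := hf
    obtain ⟨w, hw⟩ := hg
    refine ⟨u + w, ?_⟩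
    rw [add_mul, hu, hw, ← Finset.sum_add_distrib]
    refine Finset.sum_congr rfl fun i _ => ?_
    rw [← add_mul, ofBase, ofBase, ofBase, Pi.add_apply, Polynomial.map_add, map_add]
  | hterm j a =>
    obtain ⟨c, hc⟩ := hb a
    refine ⟨fun i => monomial j (c i), ?_⟩
    have : ∀ i, ofBase σ (monomial j (c i)) * term σ 0 (b i) = term σ j (c i • b i) := by
      intro i
      rw [ofBase, Polynomial.map_monomial, Algebra.smul_def]
      exact (term_mul_term _ _ _ _).trans (by rw [add_zero, pow_zero, AlgEquiv.one_apply])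
    simp only [this]
    rw [term_mul_term, add_zero, pow_zero, AlgEquiv.one_apply, mul_comm, hc]
    refine ext_coeff fun m => ?_
    rw [PiretAlgebra.coeff_sum]
    simp only [coeff_term]
    split_ifs <;> simp

/-- Right multiplication by a nonzero `g = ε_l g` is injective on `A[z;σ] ε_l`. -/
theorem mul_term_ε_eq_zero {l : Fin r} {f g : PiretAlgebra σ} (hg : P.component l g = g)
    (hg0 : g ≠ 0) (h : f * g = 0) : f * term σ 0 (P.ε l) = 0 := by
  by_contra hf
  obtain ⟨D, hD, hgD⟩ := exists_top_coeff hg0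
  obtain ⟨J, hJ, hfJ⟩ := exists_top_coeff hf
  have hfg : f * term σ 0 (P.ε l) * g = 0 := by
    rw [mul_assoc]
    exact (congrArg (f * ·) hg).trans h
  have htop := coeff_mul_top hfJ hgD
  rw [hfg, PiretAlgebra.coeff_zero] at htop
  have hD' : g.coeff D = (σ ^ D) (P.ε l) * g.coeff D := by
    rw [← coeff_term_zero_mul]
    exact (congrArg (fun f => PiretAlgebra.coeff f D) hg).symm
  rw [coeff_mul_term_zero] at hJ htop
  -- The leading coefficient of `g` lies in `σ^D(ε_l) A`. Pulling back by `σ^D` turns the top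
  -- coefficient of the product into a product of two nonzero elements of the field `ε_l A`.
  obtain ⟨a, ha⟩ := (σ ^ D).surjective (g.coeff D)
  rw [← ha, ← map_mul] at htop hD'
  rw [← ha] at hD
  have ha' := (σ ^ D).injective hD'
  have h0 := (map_eq_zero_iff _ (σ ^ D).injective).mp htop.symm
  refine P.ε_mul_mul_ne_zero (k := l) (a := f.coeff J) (b := a) ?_ ?_ ?_
  · rwa [mul_comm]
  · rw [← ha']
    rintro rfl
    exact hD (map_zero _)
  · rw [← h0]
    ring

variable [NeZero n]

/-- The matrix with the rows `𝔭⁻¹(b_i u)`, where the `b_i` are elements of `A`. -/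
noncomputable def generatorMatrix {k : ℕ} (b : Fin k → CyclicRing F n) (u : PiretAlgebra σ) :
    Matrix (Fin k) (Fin n) F[X] :=
  (Matrix.of fun i => (rootBasis F n).equivFun (b i)).map C * rightMulMatrix u

theorem 𝔭Equiv_row_generatorMatrix {k : ℕ} (b : Fin k → CyclicRing F n) (u : PiretAlgebra σ)
    (i : Fin k) : 𝔭Equiv σ ((generatorMatrix b u).row i) = term σ 0 (b i) * u := by
  rw [← 𝔭Equiv_const, ← 𝔭Equiv_vecMul_rightMulMatrix]
  rfl

theorem exists_matrix_mul_eq_one {k : ℕ} {b : Fin k → CyclicRing F n}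
    (hb : LinearIndependent F b) :
    ∃ B : Matrix (Fin n) (Fin k) F,
      (Matrix.of fun i => (rootBasis F n).equivFun (b i)) * B = 1 :=
  Matrix.exists_mul_eq_one_of_linearIndependent_row _
    (hb.map' (rootBasis F n).equivFun.toLinearMap (LinearEquiv.ker _))

/-- Both factors of the generator matrix have right inverses: the constant one by independence of
`b`, the other from `w`. -/
theorem generatorMatrix_mul_eq_one {k : ℕ} {b : Fin k → CyclicRing F n}
    (hb : LinearIndependent F b) {u w : PiretAlgebra σ} (huw : u * w = 1) :
    ∃ G' : Matrix (Fin n) (Fin k) F[X], generatorMatrix b u * G' = 1 := by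
  obtain ⟨B, hB⟩ := exists_matrix_mul_eq_one hb
  refine ⟨rightMulMatrix w * B.map C, ?_⟩
  rw [generatorMatrix, Matrix.mul_assoc, ← Matrix.mul_assoc (rightMulMatrix u),
    rightMulMatrix_mul, huw, rightMulMatrix_one, Matrix.one_mul, ← Matrix.map_mul, hB,
    Matrix.map_one _ (map_zero _) (map_one _)]

theorem exists_code {l : Fin r} (hσ : σ (P.ε l) ≠ P.ε l) (d : ℕ) :
    ∃ S : Submodule F[X] (Fin n → F[X]),
      IsMinimalCyclicCode P σ S ∧
      HasParameters S (P.π l).natDegree (d * (P.π l).natDegree) ∧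
      HasSupport P σ S {l} ∧
      HasForneyIndices S (Multiset.replicate (P.π l).natDegree d) := by
  obtain ⟨u, w, huw, htop, hdeg⟩ := P.exists_unit_degree hσ d
  obtain ⟨b, hb, hεb, hspan⟩ := P.exists_basis_ε l
  set G := generatorMatrix b u with hG
  have hrow : ∀ i, 𝔭Equiv σ (G.row i) = term σ 0 (b i) * P.component l u := by
    intro i
    rw [hG, 𝔭Equiv_row_generatorMatrix, component, ← mul_assoc, term_mul_term, pow_zero,
      AlgEquiv.one_apply, mul_comm (b i), hεb, zero_add]
  have hg0 : P.component l u ≠ 0 := by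
    intro h
    rw [← component, h, PiretAlgebra.coeff_zero] at htop
    exact P.ε_ne_zero l ((map_eq_zero_iff _ (σ ^ d).injective).mp htop.symm)
  set S := codeOfIdeal (Ideal.span {P.component l u}) with hS
  have hgen : IsGeneratorPolynomial P (P.component l u) S :=
    ⟨P.isReduced_component l u, image_codeOfIdeal _⟩
  obtain ⟨G', hGG'⟩ : ∃ G' : Matrix (Fin n) (Fin _) F[X], G * G' = 1 := generatorMatrix_mul_eq_one hb huw
  have hGS : IsGeneratorMatrix G S := by
    refine ⟨linearIndependent_of_mul_eq_one hGG', fun v => ?_⟩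
    have hvec : ∀ p, 𝔭Equiv σ (Matrix.vecMul p G) =
        ∑ i, ofBase σ (p i) * 𝔭Equiv σ (G.row i) := by
      intro p
      rw [Matrix.vecMul_eq_sum]
      exact 𝔭Equiv_sum_smul p G.row
    rw [hS, mem_codeOfIdeal, Ideal.mem_span_singleton']
    constructor
    · rintro ⟨h, hh⟩
      obtain ⟨p, hp⟩ := P.exists_sum_ofBase_mul_term hspan h
      refine ⟨p, (𝔭Equiv σ).injective ?_⟩
      rw [hvec, ← hh, component, ← mul_assoc, hp, Finset.sum_mul]
      refine Finset.sum_congr rfl fun i _ => ?_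
      rw [mul_assoc, hG, 𝔭Equiv_row_generatorMatrix]
    · rintro ⟨p, rfl⟩
      refine ⟨∑ i, ofBase σ (p i) * term σ 0 (b i), ?_⟩
      rw [hvec, Finset.sum_mul]
      refine Finset.sum_congr rfl fun i _ => ?_
      rw [hrow, mul_assoc]
  have hcoeff : ∀ i j m, (G i j).coeff m = (rootBasis F n).equivFun
      ((σ ^ m) (b i) * (P.component l u).coeff m) j := by
    intro i j m
    rw [← coeff_term_zero_mul, ← hrow, 𝔭Equiv_apply, equivFun_coeff_𝔭]
    rfl
  have hnat : ∀ i j, (G i j).natDegree ≤ d := by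
    intro i j
    refine natDegree_le_iff_coeff_eq_zero.mpr fun m hm => ?_
    rw [hcoeff, component, hdeg m hm, mul_zero, map_zero, Pi.zero_apply]
  -- The factor `σ^d(ε_l)` is absorbed, since `ε_l b_i = b_i`.
  have hlead : ∀ i j, (G i j).coeff d = (rootBasis F n).equivFun ((σ ^ d) (b i)) j := by
    intro i j
    rw [hcoeff, component, htop, ← map_mul, mul_comm, hεb]
  have hσb : LinearIndependent F fun i => (σ ^ d) (b i) :=
    hb.map' (σ ^ d).toLinearMap (LinearMap.ker_eq_bot.mpr (σ ^ d).injective)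
  have hcompl : complexity G = (P.π l).natDegree * d := by
    refine complexity_eq_mul hnat ?_
    obtain ⟨B, hB⟩ := exists_matrix_mul_eq_one hσb
    refine ⟨B, ?_⟩
    rw [← hB]
    congr 1
    ext i j
    exact hlead i j
  have hvdeg : ∀ i, vecDegree (G i) = d := by
    refine fun i => vecDegree_eq (hnat i) ?_
    by_contra! hne
    refine hσb.ne_zero i ((rootBasis F n).equivFun.injective (funext fun j => ?_))
    rw [← hlead, hne, map_zero, Pi.zero_apply]
  have hpar : HasParameters S (P.π l).natDegree (d * (P.π l).natDegree) :=
    ⟨G, hGS, ⟨G', hGG'⟩, by rw [hcompl, mul_comm]⟩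
  refine ⟨S, ⟨?_, ⟨⟨_, _, hpar⟩, _, image_codeOfIdeal _⟩, _, hgen, l, ?_⟩, hpar,
    ⟨_, hgen, P.support_component l hg0⟩, _, G, hGS, ?_, ?_⟩
  · intro hbot
    obtain ⟨v, hv⟩ := (𝔭Equiv σ).surjective (P.component l u)
    have hvS : v ∈ S := by
      rw [hS, mem_codeOfIdeal, hv]
      exact Ideal.mem_span_singleton_self _
    rw [hbot, Submodule.mem_bot] at hvS
    rw [hvS, map_zero] at hv
    exact hg0 hv.symm
  · rw [component_component_self]
  · rw [IsMinimalMatrix, hcompl]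
    simp [hvdeg]
  · simp [hvdeg]

theorem complexity_eq_zero_of_fixed {l : Fin r} (hσ : σ (P.ε l) = P.ε l)
    {S : Submodule F[X] (Fin n → F[X])} (hS : HasSupport P σ S {l}) {k δ : ℕ}
    (hpar : HasParameters S k δ) : δ = 0 := by
  obtain ⟨g, ⟨-, hgS⟩, hsupp⟩ := hS
  obtain ⟨G, hG, ⟨G', hGG'⟩, rfl⟩ := hpar
  have hg := P.component_eq_self_of_support hsupp
  have hg0 : g ≠ 0 := by
    have : P.component l g ≠ 0 := by
      change l ∈ P.support g
      rw [hsupp]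
      rfl
    rwa [hg] at this
  have hσm : ∀ m : ℕ, (σ ^ m) (P.ε l) = P.ε l := by
    intro m
    induction m with
    | zero => rfl
    | succ m ih => rw [pow_succ, AlgEquiv.mul_apply, hσ, ih]
  set e := term σ 0 (P.ε l) with he
  -- Centrality of `e` is where the assumption that `σ` fixes `ε_l` enters.
  have hcomm : ∀ f, f * e = e * f := by
    intro f
    refine ext_coeff fun m => ?_
    rw [coeff_term_zero_mul, coeff_mul_term_zero, hσm, mul_comm]
  have hee : e * e = e := by
    rw [he, term_mul_term, pow_zero, AlgEquiv.one_apply, P.ε_mul_self, zero_add]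
  have heg : e * g = g := hg
  have hmem : ∀ v, v ∈ S ↔ ∃ f, f * g = 𝔭Equiv σ v := by
    intro v
    rw [← Ideal.mem_span_singleton', ← SetLike.mem_coe, ← SetLike.mem_coe, ← hgS]
    exact (𝔭_injective.mem_set_image).symm
  -- Adding `1 - e` makes up for the part of `A[z;σ]` that `g` kills. If `v (g + (1 - e)) = 0`,
  -- multiplying by `1 - e` gives `v (1 - e) = 0`, hence `v g = 0`, hence `v e = 0`.
  have hdet : (rightMulMatrix (g + (1 - e))).det ≠ 0 := by
    intro h0
    obtain ⟨v, hv0, hv⟩ := Matrix.exists_vecMul_eq_zero_iff.mpr h0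
    have h1 := 𝔭Equiv_vecMul_rightMulMatrix v (g + (1 - e))
    rw [hv, map_zero] at h1
    have h2 : 𝔭Equiv σ v * (1 - e) = 0 := by
      have : 𝔭Equiv σ v * (g + (1 - e)) * (1 - e) = 𝔭Equiv σ v * (1 - e) := by
        have hge : g * e = g := by rw [hcomm, heg]
        simp only [mul_sub, mul_add, add_mul, sub_mul, mul_one, mul_assoc, hge, hee]
        abel
      rw [← this, ← h1, zero_mul]
    have h3 : 𝔭Equiv σ v * g = 0 := by
      rw [mul_add, h2, add_zero] at h1
      exact h1.symm
    have h4 := P.mul_term_ε_eq_zero hg hg0 h3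
    rw [mul_sub, mul_one, h4, sub_zero] at h2
    exact hv0 ((map_eq_zero_iff _ (𝔭Equiv σ).injective).mp h2)
  have hmem' : ∀ v, v ∈ S ↔ 𝔭Equiv σ v * e = 𝔭Equiv σ v := by
    intro v
    constructor
    · intro hv
      obtain ⟨f, hf⟩ := (hmem v).mp hv
      rw [← hf, mul_assoc, hcomm, heg]
    · intro hv
      -- With `p` the determinant and `w` the image of `v` under the adjugate, `p v = w (g + (1 -
      -- e))`. Right multiplication by `e` turns this into `p v = w g`.
      refine mem_of_smul_mem hG hGG' hdet ((hmem _).mpr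
        ⟨𝔭Equiv σ (Matrix.vecMul v (rightMulMatrix (g + (1 - e))).adjugate), ?_⟩)
      have h1 := 𝔭Equiv_vecMul_rightMulMatrix
        (Matrix.vecMul v (rightMulMatrix (g + (1 - e))).adjugate) (g + (1 - e))
      rw [Matrix.vecMul_vecMul, Matrix.adjugate_mul, Matrix.vecMul_smul, Matrix.vecMul_one] at h1
      have h2 := congrArg (· * e) h1
      rw [𝔭Equiv_smul, mul_assoc, hv, mul_assoc, add_mul, sub_mul, one_mul, hee, sub_self,
        add_zero, hcomm, heg] at h2
      rw [𝔭Equiv_smul, h2]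
  refine complexity_eq_zero (fun v hv m => ?_) hG hGG'
  rw [hmem'] at hv ⊢
  have hconst : (fun i => C ((v i).coeff m)) =
      fun i => C ((rootBasis F n).equivFun ((𝔭Equiv σ v).coeff m) i) := by
    funext i
    rw [𝔭Equiv_apply, equivFun_coeff_𝔭]
  rw [hconst, 𝔭Equiv_const, he, term_mul_term, pow_zero, AlgEquiv.one_apply,
    ← coeff_mul_term_zero, hv, zero_add]

end CyclicConvCode.PrimeFactorization

theorem mainTheorem1 {F : Type*} [Field F] [Fintype F] {n r : ℕ}
    (hn : Nat.Coprime n (Fintype.card F))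
    (P : CyclicConvCode.PrimeFactorization F n r)
    (σ : CyclicConvCode.CyclicRing F n ≃ₐ[F] CyclicConvCode.CyclicRing F n)
    (l : Fin r) :
    List.TFAE [
      σ (P.ε l) ≠ P.ε l,
      ∀ d : ℕ, ∃ S : Submodule F[X] (Fin n → F[X]),
        CyclicConvCode.IsMinimalCyclicCode P σ S ∧
        ConvCode.HasParameters S (P.π l).natDegree (d * (P.π l).natDegree) ∧
        CyclicConvCode.HasSupport P σ S {l} ∧
        ConvCode.HasForneyIndices S (Multiset.replicate (P.π l).natDegree d),
      ∃ S : Submodule F[X] (Fin n → F[X]),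
        CyclicConvCode.IsCyclicCode σ S ∧
        CyclicConvCode.HasSupport P σ S {l} ∧
        ∃ κ δ : ℕ, ConvCode.HasParameters S κ δ ∧ δ ≠ 0] := by
  have : NeZero n := ⟨P.ne_zero_length⟩
  tfae_have 1 → 2 := fun hσ d => P.exists_code hσ d
  tfae_have 2 → 3 := by
    intro h
    -- For `d = 1` the complexity is `deg π_l`, which is positive.
    obtain ⟨S, ⟨-, hS, -⟩, hpar, hsupp, -⟩ := h 1
    refine ⟨S, hS, hsupp, _, _, hpar, ?_⟩
    rw [one_mul]
    exact (P.irreducible l).natDegree_pos.ne'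
  tfae_have 3 → 1 := by
    rintro ⟨S, -, hsupp, κ, δ, hpar, hδ⟩ hσ
    exact hδ (P.complexity_eq_zero_of_fixed hσ hsupp hpar)
  tfae_finish
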